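/- **Setting.** Let $m\ge 0$, let $\mathcal I\subseteq\{0,1\}^m$ be a set of discrete states (which checkpoints have been visited), ordered coordinatewise, let $\mathcal P(q)\subseteq\{q'\in\mathcal I: q'\ge q\}$ be the states to which one may switch from $q\in\mathcal I$, let $\mathcal A\in\mathbb R^2$ be the arrival point, and let $A$ be a nonempty measurable space (the control set). Let $f:\mathbb R^2\times A\times\mathcal I\to\mathbb R^2$ be bounded, Lipschitz in $x$ uniformly in the other variables, and measurable in the control; let $\ell:\mathbb R^2\to\mathbb R$ be bounded and Borel; let $\lambda>0$; and for $q'\in\mathcal P(q)$, $q'\ne q$, let $C(\cdot,q,q')$ be nonnegative and continuous on $\mathbb R^2$. An admissible strategy $S=(\alpha,Q)$ from $(x,q)$ consists of a measurable control $\alpha:[0,\infty)\to A$ and of $k\le m$ switches at times $0\le t_1\le\dots\le t_k$ to states $w_1,\dots,w_k$ with $w_i\in\mathcal P(w_{i-1})$, $w_i\neq w_{i-1}$, $w_0=q$ (switches at time $0$ and simultaneous switches are allowed). $Q$ is the resulting right-continuous piecewise constant function, and $y$ the absolutely continuous solution of $y'=f(y,\alpha,Q)$ a.e., $y(0)=x$.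 Let $\tau_S\in[0,\infty]$ be the first time at which $y=\mathcal A$ and $Q=(1,\dots,1)$. Set $$J(x,q;S)=\int_0^{\tau_S}\ell(y(s))e^{-\lambda s}ds+\sum_{i=1}^k e^{-\lambda t_i}C(y(t_i),w_{i-1},w_i),\qquad v(x,q)=\inf_S J(x,q;S).$$ For finite $t\ge 0$ let $Q(t^-)$ be the state reached by the switches at times $<t$ ($q$ if there are none), and $$D_S(t)=\int_0^{t}\ell(y(s))e^{-\lambda s}ds+\sum_{t_i<t}e^{-\lambda t_i}C(y(t_i),w_{i-1},w_i)+e^{-\lambda t}\,v\big(y(t),Q(t^-)\big).$$ Say that the strict inequality holds at $(x,\hat q)$ if $v(x,\hat q)<\min\{v(x,q')+C(x,\hat q,q'): q'\in\mathcal P(\hat q),\,q'\ne\hat q\}$ (with $\min\emptyset=+\infty$). Say that the continuous-control DPP holds at $(x,\hat q)$ on $[0,t]$ if, with $y$ the trajectory from $x$ for the control $\alpha$ and the constant discrete state $\hat q$, and with $\theta=\min(t,\tau)$, where $\tau$ is the arrival time of this strategy, $$v(x,\hat q)=\inf_\alpha\Big\{\int_0^{\theta}\ell(y(s))e^{-\lambda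 s}ds+e^{-\lambda\theta}v(y(\theta),\hat q)\Big\}.$$ **Statement.** The infimum defining $v$ is finite (over a nonempty set, bounded below), and: 1. For all $(x,q)$ there is a $\hat q$, reached from $q$ by a finite (possibly empty) chain of permitted instantaneous switches, at most $m$ in number, such that $v(x,q)$ equals the total cost of these switches at $x$ plus $v(x,\hat q)$, and the strict inequality holds at $(x,\hat q)$. 2. (a) If the strict inequality holds at $(x,\hat q)$ and $v(\cdot,q')$ is lower semicontinuous at $x$ for every $q'\in\mathcal P(\hat q)$, $q'\neq\hat q$, then there is $t_0>0$ such that the continuous-control DPP holds at $(x,\hat q)$ on $[0,t]$ for all $t\in[0,t_0]$. (b) If $\delta>0$, $T\in\mathbb R$ and $v(y(s),\hat q)+\delta\le v(y(s),q')+C(y(s),\hat q,q')$ for all trajectories $y$ from $x$ with constant discrete state $\hat q$, all $s\in[0,T)$ and all $q'\in\mathcal P(\hat q)$, $q'\ne\hat q$, then the continuous-control DPP holds at $(x,\hat q)$ on $[0,t]$ for all $t\in[0,T]$. (c) If $S$ is optimal for $(x,q)$, i.e. $J(x,q;S)=v(x,q)$, and $0\le\hat t\le t\le\tau_S$ ($t$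 finite) are such that $Q(\hat t)=\hat q$ and $Q=\hat q$ on $[\hat t,t)$, then $$v(y(\hat t),\hat q)=\int_{\hat t}^{t}\ell(y(s))e^{-\lambda(s-\hat t)}ds+e^{-\lambda(t-\hat t)}v(y(t),\hat q).$$ 3. (Hybrid DPP) For all $(x,q)$ and all $t\ge0$, $v(x,q)=\inf_S D_S(\min(t,\tau_S))$. Moreover, for every $S$ and every finite $t\in[0,\tau_S]$ one has $v(x,q)\le D_S(t)$, with equality if $S$ is optimal for $(x,q)$. -/

import Mathlib

open MeasureTheory

/-- The plane with its Euclidean norm. -/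
abbrev Plane : Type := EuclideanSpace ℝ (Fin 2)

/-- The data of the hybrid orienteering problem with `m` checkpoints and control set `A`.
A discrete state is a vector in `{0,1}^m` recording which checkpoints have been visited;
`states` is the set of those which are used. -/
structure Orienteering (m : ℕ) (A : Type*) where
  /-- the finite set of discrete states -/
  states : Set (Fin m → Bool)
  /-- the multivalued map giving the permitted switchings -/
  permitted : states → Set states
  /-- the arrival point -/
  arrival : Plane
  /-- the controlled dynamics -/
  f : Plane → A → states → Plane
  /-- the running cost -/
  ell : Plane → ℝ
  /-- the switching cost -/
  C : Plane → states → states → ℝ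
  /-- the discount factor -/
  lam : ℝ

namespace Orienteering

variable {m : ℕ} {A : Type*}

/-- The standing assumptions on the data. Free-order races (`permitted q` is the set of all
states above `q`) and cross-country races (the states form a chain, `permitted q` consists of
the next state) both satisfy `permitted_le`: a visited checkpoint is never unvisited. Only the
costs of genuine permitted switches matter. -/
structure Standing [MeasurableSpace A] (P : Orienteering m A) : Prop where
  lam_pos : 0 < P.lam
  permitted_le : ∀ q : P.states, ∀ q' ∈ P.permitted q, q ≤ q'
  f_bounded : ∃ M : ℝ, ∀ x a q, ‖P.f x a q‖ ≤ M
  f_lipschitz : ∃ K : NNReal, ∀ a q, LipschitzWith K (fun x => P.f x a q)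
  f_measurable : ∀ x q, Measurable (fun a => P.f x a q)
  ell_measurable : Measurable P.ell
  ell_bounded : ∃ M : ℝ, ∀ x, |P.ell x| ≤ M
  C_nonneg : ∀ (x : Plane) (q : P.states), ∀ q' ∈ P.permitted q, q' ≠ q → 0 ≤ P.C x q q'
  C_continuous : ∀ q : P.states, ∀ q' ∈ P.permitted q, q' ≠ q →
    Continuous (fun x => P.C x q q')

variable (P : Orienteering m A)

/-- A discrete control is a finite list of switches `(t₁, w₁), …, (tₖ, wₖ)`, the pair `(tᵢ, wᵢ)`
meaning that at time `tᵢ` the discrete state becomes `wᵢ`. It is admissible from the state `q` if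
`0 ≤ t₁ ≤ … ≤ tₖ` (simultaneous switches are possible), every step of `q, w₁, …, wₖ` is a
permitted change of state, and there are at most `m` switches. -/
structure IsPlan (q : P.states) (L : List (ℝ × P.states)) : Prop where
  nonneg : ∀ e ∈ L, 0 ≤ e.1
  sorted : (L.map Prod.fst).Pairwise (· ≤ ·)
  permitted : List.IsChain (fun a b => b ∈ P.permitted a ∧ b ≠ a) (q :: L.map Prod.snd)
  length_le : L.length ≤ m

/-- The discrete state after all switches of the list. -/
def finalState (q : P.states) : List (ℝ × P.states) → P.states
  | [] => q
  | e :: L => finalState e.2 L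

/-- The switches at times `< t`. -/
noncomputable def before (t : ℝ) (L : List (ℝ × P.states)) : List (ℝ × P.states) :=
  L.filter (fun e => e.1 < t)

/-- The right-continuous piecewise constant function `Q(t)` given by the switches of `L`. -/
noncomputable def stateAt (q : P.states) (L : List (ℝ × P.states)) (t : ℝ) : P.states :=
  P.finalState q (L.filter (fun e => e.1 ≤ t))

/-- The discrete state reached by the switches at times `< t`, i.e. `Q(t_K⁺)` where `t_K` is the
last switching time before `t` (and the initial state if there is none). -/
noncomputable def stateBefore (q : P.states) (L : List (ℝ × P.states)) (t : ℝ) : P.states :=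
  P.finalState q (P.before t L)

/-- `y` solves `y' = f(y, α, Q)`, `y(0) = x` on `[0, ∞)`, in the sense of Carathéodory. -/
def IsTrajectory (x : Plane) (q : P.states) (α : ℝ → A) (L : List (ℝ × P.states))
    (y : ℝ → Plane) : Prop :=
  ContinuousOn y (Set.Ici 0) ∧
    ∀ t : ℝ, 0 ≤ t → y t = x + ∫ s in (0 : ℝ)..t, P.f (y s) (α s) (P.stateAt q L s)

/-- `(α, L)` is an admissible strategy from `(x, q)` and `y` is its trajectory. -/
def IsRun [MeasurableSpace A] (x : Plane) (q : P.states) (α : ℝ → A) (L : List (ℝ × P.states))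
    (y : ℝ → Plane) : Prop :=
  Measurable α ∧ P.IsPlan q L ∧ P.IsTrajectory x q α L y

/-- The first time at which the player is at the arrival point with all checkpoints visited
(`⊤` if this never happens). -/
noncomputable def arrivalTime (q : P.states) (L : List (ℝ × P.states)) (y : ℝ → Plane) : EReal :=
  sInf ((fun t : ℝ => (t : EReal)) ''
    {t | 0 ≤ t ∧ y t = P.arrival ∧ ∀ j, (P.stateAt q L t).1 j = true})

/-- The discounted running cost on `[0, θ)`. -/
noncomputable def runningCost (y : ℝ → Plane) (θ : EReal) : ℝ :=
  ∫ s in {s : ℝ | 0 ≤ s ∧ (s : EReal) < θ}, P.ell (y s) * Real.exp (-P.lam * s)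

/-- The sum of the discounted costs of the switches in the list. -/
noncomputable def switchCost (y : ℝ → Plane) (q : P.states) : List (ℝ × P.states) → ℝ
  | [] => 0
  | e :: L => Real.exp (-P.lam * e.1) * P.C (y e.1) q e.2 + switchCost y e.2 L

/-- The cost functional `J`. -/
noncomputable def J (q : P.states) (L : List (ℝ × P.states)) (y : ℝ → Plane) : ℝ :=
  P.runningCost y (P.arrivalTime q L y) + P.switchCost y q L

/-- The value function. -/
noncomputable def v [MeasurableSpace A] (x : Plane) (q : P.states) : ℝ :=
  sInf {c | ∃ α L y, P.IsRun x q α L y ∧ c = P.J q L y}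

/-- `v(x,q) < min (v(x,q') + C(x,q,q'))`, the minimum over the permitted `q' ≠ q` (it is `+∞`
if there are none). -/
def StrictAt [MeasurableSpace A] (x : Plane) (q : P.states) : Prop :=
  ∀ q' ∈ P.permitted q, q' ≠ q → P.v x q < P.v x q' + P.C x q q'

/-- The time `min(t, τ)`, where `τ` is the arrival time. -/
noncomputable def stopped (q : P.states) (L : List (ℝ × P.states)) (y : ℝ → Plane) (t : ℝ) : ℝ :=
  (min (t : EReal) (P.arrivalTime q L y)).toReal

/-- Running cost up to time `t`, plus the costs of the switches before `t`, plus the discounted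
value at the state reached at `t`. -/
noncomputable def hybridCost [MeasurableSpace A] (q : P.states) (L : List (ℝ × P.states))
    (y : ℝ → Plane) (t : ℝ) : ℝ :=
  P.runningCost y t + P.switchCost y q (P.before t L) +
    Real.exp (-P.lam * t) * P.v (y t) (P.stateBefore q L t)

/-- The dynamic programming identity of the purely continuous control problem in the frozen
discrete state `q`, on the time interval `[0, t]` and stopped at the arrival time. -/
def ContinuousDPP [MeasurableSpace A] (x : Plane) (q : P.states) (t : ℝ) : Prop :=
  IsGLB {c | ∃ α y, P.IsRun x q α [] y ∧
    c = P.runningCost y (P.stopped q [] y t) +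
      Real.exp (-P.lam * P.stopped q [] y t) * P.v (y (P.stopped q [] y t)) q} (P.v x q)

end Orienteering

/-! The dynamics is autonomous and the discount exponential, so strategies can be cut and pasted at
any time `t` not later than the arrival. By `J_append_delay` the cost then splits into the cost
before `t` plus `exp (-λ t)` times the cost of the tail. The tail is a competitor at the point
reached, which gives `le_J_of_split`; pasting an arbitrary continuation there gives `v_le_of_split`.
The bound on the number of switches survives pasting because each switch strictly increases the
state. Hence `v ≤ D_S ≤ J`, which contains the hybrid DPP and the equality along optimal strategies;
comparing two such equalities gives the identity between switches.

For the continuous-control principle it suffices that every strategy switching before `t` costs at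
least `v + η` for a fixed `η > 0` (`continuousDPP_of_gap`), since near-optimal strategies then do
not switch before `t`. `first_switch_le_J` reduces this to the values at the first switch. The gap
comes either from the assumed margin `δ` or from lower semicontinuity together with the bounded
speed. Optimal instantaneous switches are found by switching as long as the strict inequality fails;
the number of unvisited checkpoints bounds the process. -/

open MeasureTheory

/-! ### Global solutions of autonomous equations -/

/-- A bounded and globally Lipschitz vector field has a solution on `[0, ∞)`. -/
theorem exists_global_integral_solution {E : Type*} [NormedAddCommGroup E] [NormedSpace ℝ E]
    [CompleteSpace E] {g : E → E} {K : NNReal} {M : ℝ} (hg : LipschitzWith K g)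
    (hM : ∀ x, ‖g x‖ ≤ M) (x : E) :
    ∃ y : ℝ → E, ContinuousOn y (Set.Ici 0) ∧
      ∀ t : ℝ, 0 ≤ t → y t = x + ∫ s in (0 : ℝ)..t, g (y s) := by
  have hM0 : 0 ≤ M := (norm_nonneg _).trans (hM x)
  have hex : ∀ n : ℕ, ∃ α : ℝ → E, α 0 = x ∧
      ∀ t ∈ Set.Icc (0 : ℝ) n, HasDerivWithinAt α (g (α t)) (Set.Icc (0 : ℝ) n) t := by
    intro n
    -- With speed at most `M` a solution stays within `M * n` of `x` up to time `n`, so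
    -- Picard–Lindelöf applies on all of `[0, n]` at once.
    have hpl : IsPicardLindelof (fun _ => g) (⟨0, le_rfl, n.cast_nonneg⟩ : Set.Icc (0 : ℝ) n) x
        (⟨M, hM0⟩ * n) 0 ⟨M, hM0⟩ K := by
      refine IsPicardLindelof.of_time_independent (fun z _ => hM z) hg.lipschitzOnWith ?_
      simp
      rfl
    exact hpl.exists_eq_forall_mem_Icc_hasDerivWithinAt₀
  choose α hα0 hα using hex
  have hαc : ∀ n, ContinuousOn (α n) (Set.Icc 0 n) := fun n t ht => (hα n t ht).continuousWithinAt
  have hαr : ∀ n : ℕ, ∀ t ∈ Set.Ico (0 : ℝ) n,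
      HasDerivWithinAt (α n) (g (α n t)) (Set.Ici t) t := by
    intro n t ht
    refine (hα n t ⟨ht.1, ht.2.le⟩).mono_of_mem_nhdsWithin ?_
    exact Filter.mem_of_superset (Icc_mem_nhdsGE ht.2) (Set.Icc_subset_Icc_left ht.1)
  have hmono : ∀ n k : ℕ, n ≤ k → Set.EqOn (α n) (α k) (Set.Icc 0 n) := by
    intro n k hnk
    have hnk' : (n : ℝ) ≤ k := by exact_mod_cast hnk
    refine ODE_solution_unique (v := fun _ => g) (fun _ => hg) (hαc n) (hαr n)
      ((hαc k).mono (Set.Icc_subset_Icc_right hnk'))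
      (fun t ht => hαr k t ⟨ht.1, ht.2.trans_le hnk'⟩) (by rw [hα0, hα0])
  let y : ℝ → E := fun t => α ⌈t⌉₊ t
  have hy : ∀ n : ℕ, Set.EqOn y (α n) (Set.Icc 0 n) := fun n t ht =>
    hmono _ _ (Nat.ceil_le.2 ht.2) ⟨ht.1, Nat.le_ceil t⟩
  have hyc : ContinuousOn y (Set.Ici 0) := by
    intro t ht
    -- One unit more than the ceiling, so that `t` is not the right endpoint of the window.
    have hlt : t < (⌈t⌉₊ + 1 : ℕ) := by
      push_cast
      exact (Nat.le_ceil t).trans_lt (lt_add_one _)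
    have hc : ContinuousWithinAt y (Set.Icc 0 (⌈t⌉₊ + 1 : ℕ)) t :=
      ((hαc _).congr (hy _)) t ⟨ht, hlt.le⟩
    refine hc.mono_of_mem_nhdsWithin ?_
    rw [← Set.Ici_inter_Iic]
    exact Filter.inter_mem self_mem_nhdsWithin (mem_nhdsWithin_of_mem_nhds (Iic_mem_nhds hlt))
  refine ⟨y, hyc, fun t ht => ?_⟩
  have htn : t ≤ (⌈t⌉₊ : ℕ) := Nat.le_ceil t
  have hsub : Set.Icc 0 t ⊆ Set.Icc (0 : ℝ) (⌈t⌉₊ : ℕ) := Set.Icc_subset_Icc_right htn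
  have hint : ∫ s in (0 : ℝ)..t, g (α ⌈t⌉₊ s) = α ⌈t⌉₊ t - α ⌈t⌉₊ 0 := by
    refine intervalIntegral.integral_eq_sub_of_hasDeriv_right_of_le ht ((hαc _).mono hsub) ?_ ?_
    · intro s hs
      exact (hαr _ s ⟨hs.1.le, hs.2.trans_le htn⟩).mono Set.Ioi_subset_Ici_self
    · refine ContinuousOn.intervalIntegrable ?_
      rw [Set.uIcc_of_le ht]
      exact hg.continuous.comp_continuousOn ((hαc _).mono hsub)
  have hcongr : ∫ s in (0 : ℝ)..t, g (y s) = ∫ s in (0 : ℝ)..t, g (α ⌈t⌉₊ s) := by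
    refine intervalIntegral.integral_congr fun s hs => ?_
    rw [Set.uIcc_of_le ht] at hs
    simp only [hy _ (hsub hs)]
  rw [hcongr, hint, hα0]
  simp [y]

namespace Orienteering

variable {m : ℕ} {A : Type*} (P : Orienteering m A)

/-! ### Lists of switches -/

/-- The list of switches delayed by `t`. -/
def delay {S : Type*} (t : ℝ) (L : List (ℝ × S)) : List (ℝ × S) :=
  L.map fun e => (e.1 + t, e.2)

theorem map_snd_delay {S : Type*} (t : ℝ) (L : List (ℝ × S)) :
    (delay t L).map Prod.snd = L.map Prod.snd := by
  simp [delay, Function.comp_def]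

theorem delay_delay_neg {S : Type*} (t : ℝ) (L : List (ℝ × S)) : delay t (delay (-t) L) = L := by
  simp [delay, Function.comp_def]

theorem le_fst_of_mem_delay {S : Type*} {t : ℝ} {L : List (ℝ × S)} (h : ∀ e ∈ L, 0 ≤ e.1) :
    ∀ e ∈ delay t L, t ≤ e.1 := by
  intro e he
  obtain ⟨e', he', rfl⟩ := List.mem_map.1 he
  simpa using h e' he'

theorem pairwise_fst_delay_iff {S : Type*} (t : ℝ) (L : List (ℝ × S)) :
    ((delay t L).map Prod.fst).Pairwise (· ≤ ·) ↔ (L.map Prod.fst).Pairwise (· ≤ ·) := by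
  simp [delay, List.pairwise_map]

/-- The hypothesis says that `p` passes to earlier entries, so the entries satisfying it form an
initial segment. -/
theorem _root_.List.eq_filter_append_filter_not {S : Type*} (p : S → Bool) :
    ∀ {L : List S}, L.Pairwise (fun a b => p b → p a) →
      L = L.filter p ++ L.filter (fun a => !p a)
  | [], _ => rfl
  | a :: L, h => by
    rw [List.pairwise_cons] at h
    by_cases ha : p a
    · have := List.eq_filter_append_filter_not p h.2
      simp only [List.filter_cons, ha, if_true, List.cons_append, Bool.not_true]
      simpa using this
    · have hn : ∀ b ∈ L, ¬ p b := fun b hb hpb => ha (h.1 b hb hpb)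
      have h1 : L.filter p = [] := List.filter_eq_nil_iff.2 hn
      have h2 : L.filter (fun a => !p a) = L := List.filter_eq_self.2 (by simpa using hn)
      simp [ha, h1, h2]

theorem finalState_append (q : P.states) :
    ∀ L₁ L₂, P.finalState q (L₁ ++ L₂) = P.finalState (P.finalState q L₁) L₂ := by
  intro L₁
  induction L₁ generalizing q with
  | nil => intro L₂; rfl
  | cons e L ih => intro L₂; exact ih e.2 L₂

theorem finalState_delay (q : P.states) (t : ℝ) (L : List (ℝ × P.states)) :
    P.finalState q (delay t L) = P.finalState q L := by
  induction L generalizing q with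
  | nil => rfl
  | cons e L ih => exact ih e.2

/-- Consecutive states of `q, w₁, …, wₖ` differ by a permitted switch. -/
def Permitted (q : P.states) (L : List (ℝ × P.states)) : Prop :=
  List.IsChain (fun a b => b ∈ P.permitted a ∧ b ≠ a) (q :: L.map Prod.snd)

theorem permitted_nil (q : P.states) : P.Permitted q [] := List.isChain_singleton _

theorem permitted_cons {q : P.states} {e : ℝ × P.states} {L : List (ℝ × P.states)} :
    P.Permitted q (e :: L) ↔ (e.2 ∈ P.permitted q ∧ e.2 ≠ q) ∧ P.Permitted e.2 L := by
  simp [Permitted]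

theorem permitted_append {q : P.states} {L₁ L₂ : List (ℝ × P.states)} :
    P.Permitted q (L₁ ++ L₂) ↔ P.Permitted q L₁ ∧ P.Permitted (P.finalState q L₁) L₂ := by
  induction L₁ generalizing q with
  | nil => simp [permitted_nil, finalState]
  | cons e L ih => simp [permitted_cons, ih, finalState, and_assoc]

theorem permitted_delay {q : P.states} {t : ℝ} {L : List (ℝ × P.states)} :
    P.Permitted q (delay t L) ↔ P.Permitted q L := by
  simp [Permitted, map_snd_delay]

variable {P}

theorem exists_eq_delay {S : Type*} {t : ℝ} {L : List (ℝ × S)} (h : ∀ e ∈ L, t ≤ e.1) :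
    ∃ L', (∀ e ∈ L', 0 ≤ e.1) ∧ L = delay t L' := by
  refine ⟨delay (-t) L, fun e he => ?_, (delay_delay_neg t L).symm⟩
  obtain ⟨e', he', rfl⟩ := List.mem_map.1 he
  simpa using h e' he'

theorem fst_le_of_mem_before {t : ℝ} {L : List (ℝ × P.states)} :
    ∀ e ∈ P.before t L, e.1 ≤ t := fun e he => by
  exact (of_decide_eq_true (List.mem_filter.1 he).2).le

/-- Here the switches at time exactly `t` go to the second piece, which matches `Q(t⁻)`; in
`exists_split_le` they go to the first, which matches `Q(t)`. -/
theorem IsPlan.exists_split_lt {q : P.states} {L : List (ℝ × P.states)} (hL : P.IsPlan q L)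
    (t : ℝ) : ∃ L₂, (∀ e ∈ L₂, t ≤ e.1) ∧ L = P.before t L ++ L₂ := by
  refine ⟨L.filter fun e => !(decide (e.1 < t)), fun e he => ?_, ?_⟩
  · simpa using (List.mem_filter.1 he).2
  · refine List.eq_filter_append_filter_not _ ((List.pairwise_map.1 hL.sorted).imp ?_)
    intro a b hab
    simpa using fun h => hab.trans_lt h

theorem IsPlan.exists_split_le {q : P.states} {L : List (ℝ × P.states)} (hL : P.IsPlan q L)
    (t : ℝ) : ∃ L₂, (∀ e ∈ L₂, t < e.1) ∧ L = L.filter (fun e => decide (e.1 ≤ t)) ++ L₂ := by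
  refine ⟨L.filter fun e => !(decide (e.1 ≤ t)), fun e he => ?_, ?_⟩
  · simpa using (List.mem_filter.1 he).2
  · refine List.eq_filter_append_filter_not _ ((List.pairwise_map.1 hL.sorted).imp ?_)
    intro a b hab
    simpa using fun h => hab.trans h

theorem stateAt_append_delay_of_le (q : P.states) {L₁ : List (ℝ × P.states)}
    (L' : List (ℝ × P.states)) {t s : ℝ} (h₁ : ∀ e ∈ L₁, e.1 ≤ t) (hts : t ≤ s) :
    P.stateAt q (L₁ ++ delay t L') s = P.stateAt (P.finalState q L₁) L' (s - t) := by
  have hf : L₁.filter (fun e => decide (e.1 ≤ s)) = L₁ :=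
    List.filter_eq_self.2 fun e he => by simpa using (h₁ e he).trans hts
  have hd : (delay t L').filter (fun e => decide (e.1 ≤ s)) =
      delay t (L'.filter fun e => decide (e.1 ≤ s - t)) := by
    simp [delay, List.filter_map, Function.comp_def, le_sub_iff_add_le]
  rw [stateAt, List.filter_append, hf, hd, finalState_append, finalState_delay, stateAt]

theorem stateAt_append_of_lt (q : P.states) (L₁ : List (ℝ × P.states))
    {L₂ : List (ℝ × P.states)} {t s : ℝ} (h₂ : ∀ e ∈ L₂, t ≤ e.1) (hst : s < t) :
    P.stateAt q (L₁ ++ L₂) s = P.stateAt q L₁ s := by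
  have hf : L₂.filter (fun e => decide (e.1 ≤ s)) = [] :=
    List.filter_eq_nil_iff.2 fun e he => by simpa using hst.trans_le (h₂ e he)
  rw [stateAt, List.filter_append, hf, List.append_nil, stateAt]

theorem stateAt_nil (q : P.states) (s : ℝ) : P.stateAt q [] s = q := rfl

variable [MeasurableSpace A]

theorem Standing.le_finalState (hP : P.Standing) {q : P.states} {L : List (ℝ × P.states)}
    (hL : P.Permitted q L) : q ≤ P.finalState q L := by
  induction L generalizing q with
  | nil => exact le_rfl
  | cons e L ih =>
    rw [permitted_cons] at hL
    exact (hP.permitted_le _ _ hL.1.1).trans (ih hL.2)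

/-- Switches go strictly upwards, so a nonempty chain never returns to its start. -/
theorem Standing.eq_nil_of_finalState_eq (hP : P.Standing) {q : P.states}
    {L : List (ℝ × P.states)} (hL : P.Permitted q L) (h : P.finalState q L = q) : L = [] := by
  cases L with
  | nil => rfl
  | cons e L =>
    rw [permitted_cons] at hL
    refine absurd (le_antisymm ?_ (hP.permitted_le _ _ hL.1.1)) hL.1.2
    exact (hP.le_finalState hL.2).trans_eq h

/-- The number of visited checkpoints. -/
def visited {S : Set (Fin m → Bool)} (q : S) : ℕ := (Finset.univ.filter fun j => q.1 j = true).card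

theorem visited_le {S : Set (Fin m → Bool)} (q : S) : visited q ≤ m := by
  simpa [visited] using Finset.card_le_univ (Finset.univ.filter fun j => q.1 j = true)

theorem visited_lt_visited {S : Set (Fin m → Bool)} {q q' : S} (h : q < q') :
    visited q < visited q' := by
  refine Finset.card_lt_card ?_
  rw [Finset.ssubset_iff_of_subset]
  · by_contra! hc
    refine h.not_ge fun j => ?_
    have := hc j
    simp only [Finset.mem_filter, Finset.mem_univ, true_and] at this
    exact Bool.le_iff_imp.2 this
  · intro j
    simp only [Finset.mem_filter, Finset.mem_univ, true_and]
    exact Bool.le_iff_imp.1 (h.le j)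

theorem Standing.visited_lt (hP : P.Standing) {q q' : P.states} (h : q' ∈ P.permitted q)
    (hne : q' ≠ q) : visited q < visited q' :=
  visited_lt_visited (lt_of_le_of_ne (hP.permitted_le _ _ h) hne.symm)

theorem Standing.length_add_visited_le (hP : P.Standing) {q : P.states}
    {L : List (ℝ × P.states)} (hL : P.Permitted q L) : L.length + visited q ≤ m := by
  induction L generalizing q with
  | nil => simpa using visited_le q
  | cons e L ih =>
    rw [permitted_cons] at hL
    have h1 := ih hL.2
    have h2 := hP.visited_lt hL.1.1 hL.1.2
    simp only [List.length_cons]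
    omega

/-- Each switch visits a new checkpoint, so the bound `m` on the length is automatic and need not be
tracked when plans are concatenated. -/
theorem Standing.isPlan_iff (hP : P.Standing) {q : P.states} {L : List (ℝ × P.states)} :
    P.IsPlan q L ↔ (∀ e ∈ L, 0 ≤ e.1) ∧ (L.map Prod.fst).Pairwise (· ≤ ·) ∧ P.Permitted q L :=
  ⟨fun h => ⟨h.nonneg, h.sorted, h.permitted⟩, fun h => ⟨h.1, h.2.1, h.2.2,
    (Nat.le_add_right _ _).trans (hP.length_add_visited_le h.2.2)⟩⟩

theorem Standing.isPlan_nil (hP : P.Standing) (q : P.states) : P.IsPlan q [] :=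
  hP.isPlan_iff.2 ⟨by simp, by simp, P.permitted_nil q⟩

theorem Standing.isPlan_cons_zero (hP : P.Standing) {q w : P.states} {L : List (ℝ × P.states)}
    (hw : w ∈ P.permitted q) (hne : w ≠ q) (hL : P.IsPlan w L) : P.IsPlan q ((0, w) :: L) := by
  obtain ⟨h1, h2, h3⟩ := hP.isPlan_iff.1 hL
  refine hP.isPlan_iff.2 ⟨?_, ?_, (P.permitted_cons).2 ⟨⟨hw, hne⟩, h3⟩⟩
  · simpa using h1
  · simp only [List.map_cons, List.pairwise_cons, h2, and_true]
    intro a ha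
    obtain ⟨e, he, rfl⟩ := List.mem_map.1 ha
    exact h1 e he

theorem Standing.isPlan_append_delay (hP : P.Standing) {q : P.states}
    {L₁ L' : List (ℝ × P.states)} {t : ℝ} (ht : 0 ≤ t) (h₁ : ∀ e ∈ L₁, e.1 ≤ t)
    (h' : ∀ e ∈ L', 0 ≤ e.1) :
    P.IsPlan q (L₁ ++ delay t L') ↔ P.IsPlan q L₁ ∧ P.IsPlan (P.finalState q L₁) L' := by
  have hd : ∀ e ∈ delay t L', t ≤ e.1 := le_fst_of_mem_delay h'
  rw [hP.isPlan_iff, hP.isPlan_iff, hP.isPlan_iff, permitted_append, permitted_delay,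
    List.map_append, List.pairwise_append, pairwise_fst_delay_iff, List.forall_mem_append]
  have hc : ∀ a ∈ L₁.map Prod.fst, ∀ b ∈ (delay t L').map Prod.fst, a ≤ b := by
    intro a ha b hb
    obtain ⟨e, he, rfl⟩ := List.mem_map.1 ha
    obtain ⟨e', he', rfl⟩ := List.mem_map.1 hb
    exact (h₁ e he).trans (hd e' he')
  have hd0 : ∀ e ∈ delay t L', 0 ≤ e.1 := fun e he => ht.trans (hd e he)
  tauto

/-- A switch strictly between `t'` and `t` would belong to a nonempty chain of switches from `w`
back to `w`. -/
theorem Standing.before_eq_of_stateAt_eq (hP : P.Standing) {q w : P.states}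
    {L : List (ℝ × P.states)} (hL : P.IsPlan q L) {t' t : ℝ} (htt : t' < t)
    (hw : ∀ s : ℝ, t' ≤ s → s < t → P.stateAt q L s = w) :
    P.before t L = L.filter fun e => decide (e.1 ≤ t') := by
  refine List.filter_congr fun e he => ?_
  rw [decide_eq_decide]
  refine ⟨fun het => ?_, fun h => h.trans_lt htt⟩
  by_contra! het'
  obtain ⟨L₂, h₂, hL₂⟩ := hL.exists_split_le t'
  obtain ⟨L₃, -, hL₃⟩ := hL.exists_split_le e.1
  have hF : L.filter (fun e' => decide (e'.1 ≤ e.1)) = L.filter (fun e => decide (e.1 ≤ t')) ++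
      L₂.filter fun e' => decide (e'.1 ≤ e.1) := by
    conv_lhs => rw [hL₂]
    rw [List.filter_append]
    congr 1
    refine List.filter_eq_self.2 fun a ha => ?_
    have : a.1 ≤ t' := by simpa using (List.mem_filter.1 ha).2
    simpa using this.trans het'.le
  have hperm : P.Permitted q (L.filter (fun e => decide (e.1 ≤ t')) ++
      L₂.filter fun e' => decide (e'.1 ≤ e.1)) := by
    rw [← hF]
    have := (hP.isPlan_iff.1 hL).2.2
    rw [hL₃, permitted_append] at this
    exact this.1
  have hstate : P.finalState (P.stateAt q L t') (L₂.filter fun e' => decide (e'.1 ≤ e.1)) =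
      P.stateAt q L t' := by
    have h1 := hw e.1 het'.le het
    rw [stateAt, hF, finalState_append] at h1
    exact h1.trans (hw t' le_rfl htt).symm
  have hnil := hP.eq_nil_of_finalState_eq ((P.permitted_append).1 hperm).2 hstate
  have hmem : e ∈ L₂ := by
    rw [hL₂, List.mem_append] at he
    refine he.resolve_left fun h => het'.not_ge ?_
    simpa using (List.mem_filter.1 h).2
  exact List.filter_eq_nil_iff.1 hnil e hmem (by simp)

end Orienteering

namespace Orienteering

variable {m : ℕ} {A : Type*} {P : Orienteering m A}

/-! ### Trajectories -/

/-- The head of the list acts exactly on the half-line after its time, so induction needs only a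
two-case function; the list need not be sorted. -/
theorem measurable_comp_stateAt (q : P.states) (L : List (ℝ × P.states)) {E : Type*}
    [MeasurableSpace E] {h : ℝ → P.states → E} (hh : ∀ w, Measurable fun s => h s w) :
    Measurable fun s => h s (P.stateAt q L s) := by
  induction L generalizing q with
  | nil => exact hh q
  | cons e L ih =>
    have heq : (fun s => h s (P.stateAt q (e :: L) s)) =
        fun s => if e.1 ≤ s then h s (P.stateAt e.2 L s) else h s (P.stateAt q L s) := by
      funext s
      by_cases hs : e.1 ≤ s <;> simp [stateAt, hs, finalState]
    rw [heq]
    exact Measurable.ite measurableSet_Ici (ih e.2) (ih q)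

theorem IsTrajectory.apply_zero {x : Plane} {q : P.states} {α : ℝ → A}
    {L : List (ℝ × P.states)} {y : ℝ → Plane} (h : P.IsTrajectory x q α L y) : y 0 = x := by
  simpa using h.2 0 le_rfl

variable [MeasurableSpace A]

theorem Standing.intervalIntegrable_f (hP : P.Standing) {α : ℝ → A} (hα : Measurable α)
    {y : ℝ → Plane} (hy : ContinuousOn y (Set.Ici 0)) (q : P.states) (L : List (ℝ × P.states))
    {a b : ℝ} (ha : 0 ≤ a) (hb : 0 ≤ b) :
    IntervalIntegrable (fun s => P.f (y s) (α s) (P.stateAt q L s)) volume a b := by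
  -- `y` is controlled only on `[0, ∞)`; freezing it at negative times gives a globally continuous
  -- function with the same integrand on the interval.
  have hz : Continuous fun s => y (max s 0) :=
    hy.comp_continuous (by fun_prop) fun s => Set.mem_Ici.2 (le_max_right _ _)
  have hmeas : Measurable fun s => P.f (y (max s 0)) (α s) (P.stateAt q L s) := by
    refine measurable_comp_stateAt q L (h := fun s w => P.f (y (max s 0)) (α s) w) fun w => ?_
    obtain ⟨K, hK⟩ := hP.f_lipschitz
    have hu : Measurable (Function.uncurry fun x a => P.f x a w) :=
      measurable_uncurry_of_continuous_of_measurable (fun a => (hK a w).continuous)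
        fun x => hP.f_measurable x w
    exact hu.comp (hz.measurable.prodMk hα)
  obtain ⟨M, hM⟩ := hP.f_bounded
  have hint : IntervalIntegrable (fun s => P.f (y (max s 0)) (α s) (P.stateAt q L s))
      volume a b := by
    refine (intervalIntegrable_const (c := M)).mono_fun hmeas.aestronglyMeasurable ?_
    exact Filter.Eventually.of_forall fun s => (hM _ _ _).trans (le_abs_self M)
  refine hint.congr fun s hs => ?_
  have hs0 : 0 ≤ s := (le_min ha hb).trans (le_of_lt hs.1)
  simp only [max_eq_left hs0]

theorem Standing.isTrajectory_tail (hP : P.Standing) {x : Plane} {q : P.states} {α : ℝ → A}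
    (hα : Measurable α) {L₁ L' : List (ℝ × P.states)} {y : ℝ → Plane} {t : ℝ} (ht : 0 ≤ t)
    (h₁ : ∀ e ∈ L₁, e.1 ≤ t) (h : P.IsTrajectory x q α (L₁ ++ delay t L') y) :
    P.IsTrajectory (y t) (P.finalState q L₁) (fun s => α (s + t)) L' (fun s => y (s + t)) := by
  refine ⟨h.1.comp (by fun_prop) fun s hs => add_nonneg hs ht, fun s hs => ?_⟩
  have hst : 0 ≤ s + t := add_nonneg hs ht
  have hsplit := intervalIntegral.integral_add_adjacent_intervals
    (hP.intervalIntegrable_f hα h.1 q (L₁ ++ delay t L') le_rfl ht)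
    (hP.intervalIntegrable_f hα h.1 q (L₁ ++ delay t L') ht hst)
  have hshift := intervalIntegral.integral_comp_add_right (a := 0) (b := s)
    (fun r => P.f (y r) (α r) (P.stateAt q (L₁ ++ delay t L') r)) t
  have hcongr : ∫ r in (0 : ℝ)..s, P.f (y (r + t)) (α (r + t))
      (P.stateAt (P.finalState q L₁) L' r) = ∫ r in (0 : ℝ)..s, P.f (y (r + t)) (α (r + t))
      (P.stateAt q (L₁ ++ delay t L') (r + t)) := by
    refine intervalIntegral.integral_congr fun r hr => ?_
    rw [Set.uIcc_of_le hs] at hr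
    simp only [stateAt_append_delay_of_le q L' h₁ (by linarith [hr.1] : t ≤ r + t),
      add_sub_cancel_right]
  change y (s + t) = _
  rw [hcongr, hshift, zero_add, h.2 _ hst, h.2 t ht, ← hsplit, add_assoc]

/-- Follow `u` up to time `t`, then `u'` with time origin `t`. -/
noncomputable def glue {E : Type*} (t : ℝ) (u u' : ℝ → E) (s : ℝ) : E :=
  if s < t then u s else u' (s - t)

theorem glue_of_lt {E : Type*} {t s : ℝ} (u u' : ℝ → E) (h : s < t) : glue t u u' s = u s :=
  if_pos h

theorem glue_of_le {E : Type*} {t s : ℝ} (u u' : ℝ → E) (h : t ≤ s) :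
    glue t u u' s = u' (s - t) :=
  if_neg h.not_gt

theorem glue_of_le_of_eq {E : Type*} {t s : ℝ} {u u' : ℝ → E} (hu : u' 0 = u t) (h : s ≤ t) :
    glue t u u' s = u s := by
  rcases h.lt_or_eq with h | rfl
  · exact glue_of_lt u u' h
  · rw [glue_of_le u u' le_rfl, sub_self, hu]

theorem measurable_glue {t : ℝ} {α α' : ℝ → A} (hα : Measurable α) (hα' : Measurable α') :
    Measurable (glue t α α') :=
  Measurable.ite measurableSet_Iio hα (hα'.comp (measurable_id.sub_const t))

theorem continuousOn_glue {t : ℝ} (ht : 0 ≤ t) {y y' : ℝ → Plane}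
    (hy : ContinuousOn y (Set.Ici 0)) (hy' : ContinuousOn y' (Set.Ici 0)) (h0 : y' 0 = y t) :
    ContinuousOn (glue t y y') (Set.Ici 0) := by
  have h1 : ContinuousOn (glue t y y') (Set.Icc 0 t) :=
    (hy.mono Set.Icc_subset_Ici_self).congr fun s hs => glue_of_le_of_eq h0 hs.2
  have h2 : ContinuousOn (glue t y y') (Set.Ici t) := by
    refine ContinuousOn.congr (f := fun s => y' (s - t)) ?_ fun s hs => glue_of_le y y' hs
    exact hy'.comp (by fun_prop) fun s hs => Set.mem_Ici.2 (sub_nonneg.2 hs)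
  rw [← Set.Icc_union_Ici_eq_Ici ht]
  exact h1.union_of_isClosed h2 isClosed_Icc isClosed_Ici

theorem Standing.isTrajectory_glue (hP : P.Standing) {x : Plane} {q : P.states} {α α' : ℝ → A}
    (hα : Measurable α) (hα' : Measurable α') {L₁ L₂ L' : List (ℝ × P.states)} {y y' : ℝ → Plane}
    {t : ℝ} (ht : 0 ≤ t) (h₁ : ∀ e ∈ L₁, e.1 ≤ t) (h₂ : ∀ e ∈ L₂, t ≤ e.1)
    (h' : ∀ e ∈ L', 0 ≤ e.1) (h : P.IsTrajectory x q α (L₁ ++ L₂) y)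
    (hy' : P.IsTrajectory (y t) (P.finalState q L₁) α' L' y') :
    P.IsTrajectory x q (glue t α α') (L₁ ++ delay t L') (glue t y y') := by
  have h0 : y' 0 = y t := hy'.apply_zero
  have hc := continuousOn_glue ht h.1 hy'.1 h0
  have hfirst : ∀ s : ℝ, 0 ≤ s → s ≤ t → glue t y y' s = x + ∫ r in (0 : ℝ)..s,
      P.f (glue t y y' r) (glue t α α' r) (P.stateAt q (L₁ ++ delay t L') r) := by
    intro s hs hst
    rw [glue_of_le_of_eq h0 hst, h.2 s hs]
    congr 1
    -- The open interval matters: at `t` itself the two lists may give different states.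
    refine intervalIntegral.integral_congr_Ioo_of_le hs fun r hr => ?_
    have hrt : r < t := hr.2.trans_le hst
    simp only [glue_of_lt _ _ hrt, stateAt_append_of_lt q L₁ h₂ hrt,
      stateAt_append_of_lt q L₁ (le_fst_of_mem_delay h') hrt]
  refine ⟨hc, fun s hs => ?_⟩
  rcases le_total s t with hst | hts
  · exact hfirst s hs hst
  have hsplit := intervalIntegral.integral_add_adjacent_intervals
    (hP.intervalIntegrable_f (measurable_glue (t := t) hα hα') hc q (L₁ ++ delay t L') le_rfl ht)
    (hP.intervalIntegrable_f (measurable_glue (t := t) hα hα') hc q (L₁ ++ delay t L') ht hs)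
  have hsecond : ∫ r in t..s, P.f (glue t y y' r) (glue t α α' r)
      (P.stateAt q (L₁ ++ delay t L') r) = ∫ r in (0 : ℝ)..(s - t), P.f (y' r) (α' r)
      (P.stateAt (P.finalState q L₁) L' r) := by
    rw [← sub_self t, ← intervalIntegral.integral_comp_sub_right
      (fun r => P.f (y' r) (α' r) (P.stateAt (P.finalState q L₁) L' r)) t]
    refine intervalIntegral.integral_congr fun r hr => ?_
    rw [Set.uIcc_of_le hts] at hr
    simp only [glue_of_le _ _ hr.1, stateAt_append_delay_of_le q L' h₁ hr.1]
  rw [← hsplit, ← add_assoc, ← hfirst t ht le_rfl, hsecond, glue_of_le _ _ hts,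
    glue_of_le_of_eq h0 le_rfl]
  exact hy'.2 _ (sub_nonneg.2 hts)

theorem Standing.isRun_tail (hP : P.Standing) {x : Plane} {q : P.states} {α : ℝ → A}
    {L₁ L' : List (ℝ × P.states)} {y : ℝ → Plane} {t : ℝ} (ht : 0 ≤ t)
    (h₁ : ∀ e ∈ L₁, e.1 ≤ t) (h' : ∀ e ∈ L', 0 ≤ e.1)
    (h : P.IsRun x q α (L₁ ++ delay t L') y) :
    P.IsRun (y t) (P.finalState q L₁) (fun s => α (s + t)) L' (fun s => y (s + t)) :=
  ⟨h.1.comp (measurable_id.add_const t), ((hP.isPlan_append_delay ht h₁ h').1 h.2.1).2,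
    hP.isTrajectory_tail h.1 ht h₁ h.2.2⟩

/-- The pasting operation: `L₂` is the discarded future of the first strategy, `L'` its replacement.
-/
theorem Standing.isRun_glue (hP : P.Standing) {x : Plane} {q : P.states} {α α' : ℝ → A}
    {L₁ L₂ L' : List (ℝ × P.states)} {y y' : ℝ → Plane} {t : ℝ} (ht : 0 ≤ t)
    (h₁ : ∀ e ∈ L₁, e.1 ≤ t) (h₂ : ∀ e ∈ L₂, 0 ≤ e.1)
    (h : P.IsRun x q α (L₁ ++ delay t L₂) y)
    (h' : P.IsRun (y t) (P.finalState q L₁) α' L' y') :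
    P.IsRun x q (glue t α α') (L₁ ++ delay t L') (glue t y y') :=
  ⟨measurable_glue h.1 h'.1, (hP.isPlan_append_delay ht h₁ h'.2.1.nonneg).2
      ⟨((hP.isPlan_append_delay ht h₁ h₂).1 h.2.1).1, h'.2.1⟩,
    hP.isTrajectory_glue h.1 h'.1 ht h₁ (le_fst_of_mem_delay h₂) h'.2.1.nonneg h.2.2 h'.2.2⟩

/-- A constant control without switches makes the equation autonomous. -/
theorem Standing.exists_isRun [Nonempty A] (hP : P.Standing) (x : Plane) (q : P.states) :
    ∃ α y, P.IsRun x q α [] y := by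
  obtain ⟨M, hM⟩ := hP.f_bounded
  obtain ⟨K, hK⟩ := hP.f_lipschitz
  let a : A := Classical.arbitrary A
  obtain ⟨y, hyc, hy⟩ := exists_global_integral_solution (hK a q) (fun z => hM z a q) x
  exact ⟨fun _ => a, y, measurable_const, hP.isPlan_nil q, hyc, hy⟩

theorem Standing.isRun_cons_zero (hP : P.Standing) {x : Plane} {q w : P.states} {α : ℝ → A}
    {L : List (ℝ × P.states)} {y : ℝ → Plane} (hw : w ∈ P.permitted q) (hne : w ≠ q)
    (h : P.IsRun x w α L y) : P.IsRun x q α ((0, w) :: L) y := by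
  refine ⟨h.1, hP.isPlan_cons_zero hw hne h.2.1, h.2.2.1, fun t ht => ?_⟩
  rw [h.2.2.2 t ht]
  congr 1
  refine intervalIntegral.integral_congr fun s hs => ?_
  rw [Set.uIcc_of_le ht] at hs
  simp [stateAt, hs.1, finalState]

theorem IsRun.dist_le {M : ℝ} (hM : ∀ x a q, ‖P.f x a q‖ ≤ M) {x : Plane} {q : P.states}
    {α : ℝ → A} {L : List (ℝ × P.states)} {y : ℝ → Plane}
    (h : P.IsRun x q α L y) {t : ℝ} (ht : 0 ≤ t) : dist (y t) x ≤ M * t := by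
  rw [dist_eq_norm, h.2.2.2 t ht, add_sub_cancel_left]
  have := intervalIntegral.norm_integral_le_of_norm_le_const (a := 0) (b := t) (C := M)
    (f := fun s => P.f (y s) (α s) (P.stateAt q L s)) fun s _ => hM _ _ _
  rwa [sub_zero, abs_of_nonneg ht] at this

end Orienteering

namespace Orienteering

variable {m : ℕ} {A : Type*} {P : Orienteering m A}

/-! ### Arrival times -/

theorem le_arrivalTime_iff {q : P.states} {L : List (ℝ × P.states)} {y : ℝ → Plane} {c : EReal} :
    c ≤ P.arrivalTime q L y ↔ ∀ r : ℝ, 0 ≤ r → y r = P.arrival →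
      (∀ j, (P.stateAt q L r).1 j = true) → c ≤ r := by
  simp only [arrivalTime, le_sInf_iff, Set.forall_mem_image, Set.mem_ofPred_eq]
  exact ⟨fun h r h1 h2 h3 => h ⟨h1, h2, h3⟩, fun h r hr => h r hr.1 hr.2.1 hr.2.2⟩

theorem arrivalTime_le {q : P.states} {L : List (ℝ × P.states)} {y : ℝ → Plane} {r : ℝ}
    (h0 : 0 ≤ r) (hy : y r = P.arrival) (hq : ∀ j, (P.stateAt q L r).1 j = true) :
    P.arrivalTime q L y ≤ r :=
  le_arrivalTime_iff.1 le_rfl r h0 hy hq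

theorem arrivalTime_nonneg (q : P.states) (L : List (ℝ × P.states)) (y : ℝ → Plane) :
    0 ≤ P.arrivalTime q L y :=
  le_arrivalTime_iff.2 fun _ hr _ _ => EReal.coe_nonneg.2 hr

theorem arrivalTime_append_delay {q : P.states} {L₁ L' : List (ℝ × P.states)} {y : ℝ → Plane}
    {t : ℝ} (ht : 0 ≤ t) (h₁ : ∀ e ∈ L₁, e.1 ≤ t)
    (hτ : (t : EReal) ≤ P.arrivalTime q (L₁ ++ delay t L') y) :
    P.arrivalTime q (L₁ ++ delay t L') y =
      P.arrivalTime (P.finalState q L₁) L' (fun s => y (s + t)) + t := by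
  apply le_antisymm
  · rw [← EReal.sub_le_iff_le_add (Or.inl (EReal.coe_ne_bot t)) (Or.inl (EReal.coe_ne_top t)),
      le_arrivalTime_iff]
    intro r hr hy hq
    rw [EReal.sub_le_iff_le_add (Or.inl (EReal.coe_ne_bot t)) (Or.inl (EReal.coe_ne_top t)),
      ← EReal.coe_add]
    refine arrivalTime_le (add_nonneg hr ht) hy ?_
    rwa [stateAt_append_delay_of_le q L' h₁ (le_add_of_nonneg_left hr), add_sub_cancel_right]
  · rw [le_arrivalTime_iff]
    intro r hr hy hq
    have htr : t ≤ r := EReal.coe_le_coe_iff.1 (hτ.trans (arrivalTime_le hr hy hq))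
    rw [stateAt_append_delay_of_le q L' h₁ htr] at hq
    have hle : P.arrivalTime (P.finalState q L₁) L' (fun s => y (s + t)) ≤ ((r - t : ℝ) : EReal) :=
      arrivalTime_le (sub_nonneg.2 htr) (by simpa using hy) hq
    calc _ ≤ ((r - t : ℝ) : EReal) + t := by gcongr
      _ = r := by rw [← EReal.coe_add, sub_add_cancel]

/-- Agreement on `[0, t)` suffices, since arrivals from `t` on do not affect the minimum. This
controls the arrival time when the future after `t` is replaced. -/
theorem min_arrivalTime_le_of_eqOn {q q' : P.states} {L L' : List (ℝ × P.states)}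
    {y y' : ℝ → Plane} {t : ℝ} (hy : ∀ s, 0 ≤ s → s < t → y s = y' s)
    (hL : ∀ s, 0 ≤ s → s < t → P.stateAt q L s = P.stateAt q' L' s) :
    min (t : EReal) (P.arrivalTime q L y) ≤ P.arrivalTime q' L' y' := by
  rw [le_arrivalTime_iff]
  intro r hr hyr hqr
  rcases lt_or_ge r t with hrt | hrt
  · refine (min_le_right _ _).trans (arrivalTime_le hr ?_ ?_)
    · rwa [hy r hr hrt]
    · rwa [hL r hr hrt]
  · exact (min_le_left _ _).trans (EReal.coe_le_coe_iff.2 hrt)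

theorem min_arrivalTime_congr {q q' : P.states} {L L' : List (ℝ × P.states)}
    {y y' : ℝ → Plane} {t : ℝ} (hy : ∀ s, 0 ≤ s → s < t → y s = y' s)
    (hL : ∀ s, 0 ≤ s → s < t → P.stateAt q L s = P.stateAt q' L' s) :
    min (t : EReal) (P.arrivalTime q L y) = min (t : EReal) (P.arrivalTime q' L' y') :=
  le_antisymm (le_min (min_le_left _ _) (min_arrivalTime_le_of_eqOn hy hL))
    (le_min (min_le_left _ _) (min_arrivalTime_le_of_eqOn (fun s h0 h => (hy s h0 h).symm)
      fun s h0 h => (hL s h0 h).symm))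

theorem coe_stopped {q : P.states} {L : List (ℝ × P.states)} {y : ℝ → Plane} {t : ℝ}
    (ht : 0 ≤ t) : (P.stopped q L y t : EReal) = min (t : EReal) (P.arrivalTime q L y) := by
  refine EReal.coe_toReal ?_ ?_
  · exact ((min_le_left _ _).trans_lt (EReal.coe_lt_top t)).ne
  · refine (EReal.bot_lt_zero.trans_le (le_min ?_ (arrivalTime_nonneg q L y))).ne'
    exact EReal.coe_nonneg.2 ht

theorem stopped_nonneg {q : P.states} {L : List (ℝ × P.states)} {y : ℝ → Plane} {t : ℝ}
    (ht : 0 ≤ t) : 0 ≤ P.stopped q L y t := by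
  rw [← EReal.coe_nonneg, coe_stopped ht]
  exact le_min (EReal.coe_nonneg.2 ht) (arrivalTime_nonneg q L y)

theorem stopped_le {q : P.states} {L : List (ℝ × P.states)} {y : ℝ → Plane} {t : ℝ}
    (ht : 0 ≤ t) : P.stopped q L y t ≤ t := by
  rw [← EReal.coe_le_coe_iff, coe_stopped ht]
  exact min_le_left _ _

theorem stopped_le_arrivalTime {q : P.states} {L : List (ℝ × P.states)} {y : ℝ → Plane} {t : ℝ}
    (ht : 0 ≤ t) : (P.stopped q L y t : EReal) ≤ P.arrivalTime q L y := by
  rw [coe_stopped ht]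
  exact min_le_right _ _

/-! ### Costs -/

theorem measurableSet_running (θ : EReal) : MeasurableSet {s : ℝ | 0 ≤ s ∧ (s : EReal) < θ} :=
  measurableSet_Ici.inter (measurableSet_lt measurable_coe_real_ereal measurable_const)

theorem runningCost_congr {y y' : ℝ → Plane} {θ : EReal}
    (h : ∀ s : ℝ, 0 ≤ s → (s : EReal) < θ → y s = y' s) :
    P.runningCost y θ = P.runningCost y' θ :=
  setIntegral_congr_fun (measurableSet_running θ) fun s hs => by simp only [h s hs.1 hs.2]

theorem runningCost_eq_intervalIntegral (y : ℝ → Plane) {t : ℝ} (ht : 0 ≤ t) :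
    P.runningCost y t = ∫ s in (0 : ℝ)..t, P.ell (y s) * Real.exp (-P.lam * s) := by
  rw [intervalIntegral.integral_of_le ht, ← integral_Ico_eq_integral_Ioc]
  simp [runningCost, Set.Ico]

theorem switchCost_congr {y y' : ℝ → Plane} {q : P.states} {L : List (ℝ × P.states)}
    (h : ∀ e ∈ L, y e.1 = y' e.1) : P.switchCost y q L = P.switchCost y' q L := by
  induction L generalizing q with
  | nil => rfl
  | cons e L ih =>
    simp only [switchCost, h e List.mem_cons_self,
      ih fun e' he' => h e' (List.mem_cons_of_mem _ he')]

theorem switchCost_append (y : ℝ → Plane) (q : P.states) (L₁ L₂ : List (ℝ × P.states)) :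
    P.switchCost y q (L₁ ++ L₂) = P.switchCost y q L₁ + P.switchCost y (P.finalState q L₁) L₂ := by
  induction L₁ generalizing q with
  | nil => simp [switchCost, finalState]
  | cons e L ih => simp [switchCost, finalState, ih, add_assoc]

theorem switchCost_delay (y : ℝ → Plane) (q : P.states) (t : ℝ) (L : List (ℝ × P.states)) :
    P.switchCost y q (delay t L) =
      Real.exp (-P.lam * t) * P.switchCost (fun s => y (s + t)) q L := by
  induction L generalizing q with
  | nil => simp [delay, switchCost]
  | cons e L ih =>
    have := ih e.2
    simp only [delay, List.map_cons, switchCost] at this ⊢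
    rw [this, mul_add, Real.exp_add]
    ring

theorem J_congr {y y' : ℝ → Plane} {q : P.states} {L : List (ℝ × P.states)}
    (hL : ∀ e ∈ L, 0 ≤ e.1) (h : ∀ s, 0 ≤ s → y s = y' s) : P.J q L y = P.J q L y' := by
  have hτ : P.arrivalTime q L y = P.arrivalTime q L y' := by
    apply le_antisymm <;> rw [le_arrivalTime_iff] <;> intro r hr hy hq
    · exact arrivalTime_le hr (by rwa [h r hr]) hq
    · exact arrivalTime_le hr (by rwa [← h r hr]) hq
  rw [J, J, hτ, runningCost_congr fun s hs _ => h s hs, switchCost_congr fun e he => h _ (hL e he)]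

theorem J_cons_zero (q : P.states) (w : P.states) {L : List (ℝ × P.states)} (y : ℝ → Plane) :
    P.J q ((0, w) :: L) y = P.C (y 0) q w + P.J w L y := by
  have hstate : ∀ r : ℝ, 0 ≤ r → P.stateAt q ((0, w) :: L) r = P.stateAt w L r := by
    intro r hr
    simp [stateAt, hr, finalState]
  have hτ : P.arrivalTime q ((0, w) :: L) y = P.arrivalTime w L y := by
    apply le_antisymm <;> rw [le_arrivalTime_iff] <;> intro r hr hy hq
    · exact arrivalTime_le hr hy (by rwa [hstate r hr])
    · exact arrivalTime_le hr hy (by rwa [← hstate r hr])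
  rw [J, J, hτ, switchCost]
  simp only [mul_zero, Real.exp_zero, one_mul]
  ring

variable [MeasurableSpace A]

theorem Standing.switchCost_nonneg (hP : P.Standing) (y : ℝ → Plane) {q : P.states}
    {L : List (ℝ × P.states)} (hL : P.Permitted q L) : 0 ≤ P.switchCost y q L := by
  induction L generalizing q with
  | nil => exact le_rfl
  | cons e L ih =>
    rw [permitted_cons] at hL
    exact add_nonneg (mul_nonneg (Real.exp_pos _).le (hP.C_nonneg _ _ _ hL.1.1 hL.1.2)) (ih hL.2)

theorem Standing.integrableOn_exp (hP : P.Standing) :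
    IntegrableOn (fun s => Real.exp (-P.lam * s)) (Set.Ici 0) :=
  integrableOn_Ici_iff_integrableOn_Ioi (by simp) |>.2 (exp_neg_integrableOn_Ioi 0 hP.lam_pos)

theorem Standing.integrableOn_running (hP : P.Standing) {y : ℝ → Plane}
    (hy : ContinuousOn y (Set.Ici 0)) :
    IntegrableOn (fun s => P.ell (y s) * Real.exp (-P.lam * s)) (Set.Ici 0) := by
  obtain ⟨M, hM⟩ := hP.ell_bounded
  refine Integrable.bdd_mul hP.integrableOn_exp (c := M) ?_
    (Filter.Eventually.of_forall fun s => hM _)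
  exact (hP.ell_measurable.comp_aemeasurable
    (hy.aemeasurable measurableSet_Ici)).aestronglyMeasurable

/-- Discounting bounds the running cost uniformly, even for `θ = ⊤`; with nonnegative switching
costs this bounds `J` below. -/
theorem Standing.exists_abs_runningCost_le (hP : P.Standing) :
    ∃ B : ℝ, ∀ (y : ℝ → Plane) (θ : EReal), |P.runningCost y θ| ≤ B := by
  obtain ⟨M, hM⟩ := hP.ell_bounded
  have hM0 : 0 ≤ M := (abs_nonneg _).trans (hM 0)
  have hint : IntegrableOn (fun s => M * Real.exp (-P.lam * s)) (Set.Ici 0) :=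
    hP.integrableOn_exp.const_mul M
  refine ⟨∫ s in Set.Ici 0, M * Real.exp (-P.lam * s), fun y θ => ?_⟩
  have hsub : {s : ℝ | 0 ≤ s ∧ (s : EReal) < θ} ⊆ Set.Ici 0 := fun s hs => hs.1
  have hint' : Integrable (fun s => M * Real.exp (-P.lam * s))
      (volume.restrict {s : ℝ | 0 ≤ s ∧ (s : EReal) < θ}) := hint.mono_set hsub
  rw [← Real.norm_eq_abs, runningCost]
  refine (norm_integral_le_of_norm_le hint' ?_).trans ?_
  · refine Filter.Eventually.of_forall fun s => ?_
    rw [norm_mul, Real.norm_of_nonneg (Real.exp_pos _).le]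
    exact mul_le_mul_of_nonneg_right (hM _) (Real.exp_pos _).le
  · refine setIntegral_mono_set hint (Filter.Eventually.of_forall fun s => ?_)
      hsub.eventuallyLE
    exact mul_nonneg hM0 (Real.exp_pos _).le

theorem Standing.abs_runningCost_le (hP : P.Standing) {M : ℝ} (hM : ∀ x, |P.ell x| ≤ M)
    (y : ℝ → Plane) {t : ℝ} (ht : 0 ≤ t) : |P.runningCost y t| ≤ M * t := by
  rw [runningCost_eq_intervalIntegral y ht]
  have hM0 : 0 ≤ M := (abs_nonneg _).trans (hM 0)
  have := intervalIntegral.norm_integral_le_of_norm_le_const (a := 0) (b := t) (C := M)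
    (f := fun s => P.ell (y s) * Real.exp (-P.lam * s)) fun s hs => by
      rw [Set.uIoc_of_le ht] at hs
      rw [norm_mul, Real.norm_of_nonneg (Real.exp_pos _).le]
      refine (mul_le_mul (hM _) (Real.exp_le_one_iff.2 ?_) (Real.exp_pos _).le hM0).trans_eq
        (mul_one M)
      nlinarith [hP.lam_pos, hs.1]
  rwa [sub_zero, abs_of_nonneg ht] at this

theorem Standing.runningCost_add (hP : P.Standing) {y : ℝ → Plane}
    (hy : ContinuousOn y (Set.Ici 0)) {t : ℝ} (ht : 0 ≤ t) {θ : EReal} (hθ : 0 ≤ θ) :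
    P.runningCost y (θ + t) =
      P.runningCost y t + Real.exp (-P.lam * t) * P.runningCost (fun s => y (s + t)) θ := by
  have hunion : {s : ℝ | 0 ≤ s ∧ (s : EReal) < θ + t} =
      {s : ℝ | 0 ≤ s ∧ (s : EReal) < t} ∪ {s : ℝ | t ≤ s ∧ (s : EReal) < θ + t} := by
    ext s
    simp only [Set.mem_ofPred_eq, Set.mem_union, EReal.coe_lt_coe_iff]
    constructor
    · intro h
      rcases lt_or_ge s t with hs | hs
      · exact Or.inl ⟨h.1, hs⟩
      · exact Or.inr ⟨hs, h.2⟩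
    · rintro (h | h)
      · refine ⟨h.1, (EReal.coe_lt_coe_iff.2 h.2).trans_le ?_⟩
        exact le_add_of_nonneg_left hθ
      · exact ⟨ht.trans h.1, h.2⟩
  have hdisj : Disjoint {s : ℝ | 0 ≤ s ∧ (s : EReal) < t}
      {s : ℝ | t ≤ s ∧ (s : EReal) < θ + t} := by
    refine Set.disjoint_left.2 fun s hs hs' => ?_
    exact absurd (EReal.coe_lt_coe_iff.1 hs.2) hs'.1.not_gt
  have hmeas : MeasurableSet {s : ℝ | t ≤ s ∧ (s : EReal) < θ + t} :=
    measurableSet_Ici.inter (measurableSet_lt measurable_coe_real_ereal measurable_const)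
  have hpre : (fun s : ℝ => s + t) ⁻¹' {s : ℝ | t ≤ s ∧ (s : EReal) < θ + t} =
      {s : ℝ | 0 ≤ s ∧ (s : EReal) < θ} := by
    ext s
    simp only [Set.mem_preimage, Set.mem_ofPred_eq, le_add_iff_nonneg_left, EReal.coe_add]
    refine and_congr_right fun _ => ⟨fun h => lt_of_not_ge fun hle => h.not_ge ?_, fun h => ?_⟩
    · gcongr
    · exact EReal.add_lt_add_right_coe h t
  have hint := hP.integrableOn_running hy
  have hshift := (measurePreserving_add_right volume t).setIntegral_preimage_emb
    (measurableEmbedding_addRight t) (fun s => P.ell (y s) * Real.exp (-P.lam * s))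
    {s : ℝ | t ≤ s ∧ (s : EReal) < θ + t}
  rw [runningCost, hunion, setIntegral_union hdisj hmeas (hint.mono_set fun s hs => hs.1)
    (hint.mono_set fun s hs => ht.trans hs.1), ← hshift, hpre, runningCost, runningCost,
    ← integral_const_mul]
  congr 2
  funext s
  rw [mul_add, Real.exp_add]
  ring

/-- All dynamic programming rests on this identity. The condition on the arrival time ensures that
the tail inherits exactly the remaining time to arrival. -/
theorem Standing.J_append_delay (hP : P.Standing) {y : ℝ → Plane}
    (hy : ContinuousOn y (Set.Ici 0)) {q : P.states} {L₁ L' : List (ℝ × P.states)} {t : ℝ}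
    (ht : 0 ≤ t) (h₁ : ∀ e ∈ L₁, e.1 ≤ t)
    (hτ : (t : EReal) ≤ P.arrivalTime q (L₁ ++ delay t L') y) :
    P.J q (L₁ ++ delay t L') y = P.runningCost y t + P.switchCost y q L₁ +
      Real.exp (-P.lam * t) * P.J (P.finalState q L₁) L' (fun s => y (s + t)) := by
  rw [J, J, arrivalTime_append_delay ht h₁ hτ, hP.runningCost_add hy ht (arrivalTime_nonneg _ _ _),
    switchCost_append, switchCost_delay]
  ring

end Orienteering

namespace Orienteering

variable {m : ℕ} {A : Type*} {P : Orienteering m A} [MeasurableSpace A]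

/-! ### The value function -/

theorem Standing.bddBelow_costs (hP : P.Standing) (x : Plane) (q : P.states) :
    BddBelow {c | ∃ α L y, P.IsRun x q α L y ∧ c = P.J q L y} := by
  obtain ⟨B, hB⟩ := hP.exists_abs_runningCost_le
  refine ⟨-B, ?_⟩
  rintro c ⟨α, L, y, h, rfl⟩
  have h1 := hP.switchCost_nonneg y (hP.isPlan_iff.1 h.2.1).2.2
  have h2 := (abs_le.1 (hB y (P.arrivalTime q L y))).1
  rw [J]
  linarith

theorem Standing.v_le_J (hP : P.Standing) {x : Plane} {q : P.states} {α : ℝ → A}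
    {L : List (ℝ × P.states)} {y : ℝ → Plane} (h : P.IsRun x q α L y) :
    P.v x q ≤ P.J q L y :=
  csInf_le (hP.bddBelow_costs x q) ⟨α, L, y, h, rfl⟩

theorem Standing.le_J_of_split (hP : P.Standing) {x : Plane} {q : P.states} {α : ℝ → A}
    {L₁ L₂ : List (ℝ × P.states)} {y : ℝ → Plane} {t : ℝ} (ht : 0 ≤ t)
    (h₁ : ∀ e ∈ L₁, e.1 ≤ t) (h₂ : ∀ e ∈ L₂, t ≤ e.1) (h : P.IsRun x q α (L₁ ++ L₂) y)
    (hτ : (t : EReal) ≤ P.arrivalTime q (L₁ ++ L₂) y) :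
    P.runningCost y t + P.switchCost y q L₁ +
      Real.exp (-P.lam * t) * P.v (y t) (P.finalState q L₁) ≤ P.J q (L₁ ++ L₂) y := by
  obtain ⟨L', h', rfl⟩ := exists_eq_delay h₂
  rw [hP.J_append_delay h.2.2.1 ht h₁ hτ]
  gcongr
  exact hP.v_le_J (hP.isRun_tail ht h₁ h' h)

theorem Standing.hybridCost_le_J (hP : P.Standing) {x : Plane} {q : P.states} {α : ℝ → A}
    {L : List (ℝ × P.states)} {y : ℝ → Plane} (h : P.IsRun x q α L y) {t : ℝ} (ht : 0 ≤ t)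
    (hτ : (t : EReal) ≤ P.arrivalTime q L y) : P.hybridCost q L y t ≤ P.J q L y := by
  obtain ⟨L₂, h₂, hL⟩ := h.2.1.exists_split_lt t
  have h' := h
  rw [hL] at h' hτ
  have := hP.le_J_of_split ht fst_le_of_mem_before h₂ h' hτ
  rwa [← hL] at this

/-- A state with a permitted switch to a different state is not `(1,…,1)`, so arrival cannot precede
the first switch and the strategy may be cut there. -/
theorem Standing.first_switch_le_J (hP : P.Standing) {x : Plane} {q : P.states} {α : ℝ → A}
    {e : ℝ × P.states} {L : List (ℝ × P.states)} {y : ℝ → Plane}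
    (h : P.IsRun x q α (e :: L) y) :
    (e.1 : EReal) ≤ P.arrivalTime q (e :: L) y ∧
    P.runningCost y e.1 + Real.exp (-P.lam * e.1) * (P.v (y e.1) e.2 + P.C (y e.1) q e.2) ≤
      P.J q (e :: L) y := by
  have hsorted : ∀ e' ∈ L, e.1 ≤ e'.1 := fun e' he' =>
    (List.pairwise_cons.1 (List.pairwise_map.1 h.2.1.sorted)).1 e' he'
  have hperm := (P.permitted_cons.1 (hP.isPlan_iff.1 h.2.1).2.2).1
  have hτ : (e.1 : EReal) ≤ P.arrivalTime q (e :: L) y := by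
    rw [le_arrivalTime_iff]
    intro r _ _ hq
    rw [EReal.coe_le_coe_iff]
    by_contra! hr
    have hst : P.stateAt q ([] ++ e :: L) r = P.stateAt q [] r :=
      stateAt_append_of_lt q [] (by simpa using hsorted) hr
    rw [List.nil_append, stateAt_nil] at hst
    rw [hst] at hq
    refine hperm.2 (le_antisymm (fun j => ?_) (hP.permitted_le _ _ hperm.1))
    rw [hq j]
    exact Bool.le_true _
  refine ⟨hτ, ?_⟩
  -- Only the first switch is charged to the first piece; further switches at the same time belong
  -- to the tail.
  have := hP.le_J_of_split (L₁ := [e]) (L₂ := L) (h.2.1.nonneg e List.mem_cons_self) (by simp)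
    hsorted h hτ
  simp only [switchCost, finalState, List.cons_append, List.nil_append] at this
  linarith

variable [Nonempty A]

theorem Standing.nonempty_costs (hP : P.Standing) (x : Plane) (q : P.states) :
    {c | ∃ α L y, P.IsRun x q α L y ∧ c = P.J q L y}.Nonempty := by
  obtain ⟨α, y, h⟩ := hP.exists_isRun x q
  exact ⟨_, α, [], y, h, rfl⟩

theorem Standing.isGLB_v (hP : P.Standing) (x : Plane) (q : P.states) :
    IsGLB {c | ∃ α L y, P.IsRun x q α L y ∧ c = P.J q L y} (P.v x q) :=
  isGLB_csInf (hP.nonempty_costs x q) (hP.bddBelow_costs x q)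

theorem Standing.le_v (hP : P.Standing) {x : Plane} {q : P.states} {c : ℝ}
    (h : ∀ α L y, P.IsRun x q α L y → c ≤ P.J q L y) : c ≤ P.v x q := by
  refine le_csInf (hP.nonempty_costs x q) ?_
  rintro _ ⟨α, L, y, hr, rfl⟩
  exact h α L y hr

theorem Standing.exists_J_lt (hP : P.Standing) (x : Plane) (q : P.states) {ε : ℝ} (hε : 0 < ε) :
    ∃ α L y, P.IsRun x q α L y ∧ P.J q L y < P.v x q + ε := by
  obtain ⟨_, ⟨α, L, y, h, rfl⟩, hlt⟩ :=
    exists_lt_of_csInf_lt (hP.nonempty_costs x q) (lt_add_of_pos_right (P.v x q) hε)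
  exact ⟨α, L, y, h, hlt⟩

theorem Standing.v_le_add_switch (hP : P.Standing) (x : Plane) {q w : P.states}
    (hw : w ∈ P.permitted q) (hne : w ≠ q) : P.v x q ≤ P.v x w + P.C x q w := by
  rw [← sub_le_iff_le_add]
  refine hP.le_v fun α L y h => ?_
  have h1 := hP.v_le_J (hP.isRun_cons_zero hw hne h)
  rw [J_cons_zero, h.2.2.apply_zero] at h1
  linarith

/-! ### Dynamic programming -/

theorem Standing.v_le_of_split (hP : P.Standing) {x : Plane} {q : P.states} {α : ℝ → A}
    {L₁ L₂ : List (ℝ × P.states)} {y : ℝ → Plane} {t : ℝ} (ht : 0 ≤ t)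
    (h₁ : ∀ e ∈ L₁, e.1 ≤ t) (h₂ : ∀ e ∈ L₂, t ≤ e.1) (h : P.IsRun x q α (L₁ ++ L₂) y)
    (hτ : (t : EReal) ≤ P.arrivalTime q (L₁ ++ L₂) y) :
    P.v x q ≤ P.runningCost y t + P.switchCost y q L₁ +
      Real.exp (-P.lam * t) * P.v (y t) (P.finalState q L₁) := by
  have hexp := Real.exp_pos (-P.lam * t)
  -- Solved for the value at `t`, the claim is a lower bound for every continuation, so no
  -- approximation by near-optimal ones is needed.
  have key : (P.v x q - (P.runningCost y t + P.switchCost y q L₁)) / Real.exp (-P.lam * t) ≤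
      P.v (y t) (P.finalState q L₁) := by
    refine hP.le_v fun α' L' y' h' => ?_
    have h'0 : y' 0 = y t := h'.2.2.apply_zero
    obtain ⟨L₂', h₂', rfl⟩ := exists_eq_delay h₂
    have hrun := hP.isRun_glue ht h₁ h₂' h h'
    have hτ' : (t : EReal) ≤ P.arrivalTime q (L₁ ++ delay t L') (glue t y y') := by
      have := min_arrivalTime_le_of_eqOn (P := P) (q := q) (q' := q)
        (L := L₁ ++ delay t L₂') (L' := L₁ ++ delay t L') (y := y) (y' := glue t y y') (t := t)
        (fun s _ hs => (glue_of_lt y y' hs).symm) fun s _ hs => by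
          rw [stateAt_append_of_lt q L₁ h₂ hs,
            stateAt_append_of_lt q L₁ (le_fst_of_mem_delay h'.2.1.nonneg) hs]
      rwa [min_eq_left hτ] at this
    have hJ := hP.J_append_delay hrun.2.2.1 ht h₁ hτ'
    have e1 : P.runningCost (glue t y y') t = P.runningCost y t :=
      runningCost_congr fun s _ hs => glue_of_lt y y' (EReal.coe_lt_coe_iff.1 hs)
    have e2 : P.switchCost (glue t y y') q L₁ = P.switchCost y q L₁ :=
      switchCost_congr fun e he => glue_of_le_of_eq h'0 (h₁ e he)
    have e3 : P.J (P.finalState q L₁) L' (fun s => glue t y y' (s + t)) =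
        P.J (P.finalState q L₁) L' y' :=
      J_congr h'.2.1.nonneg fun s hs => by
        rw [glue_of_le y y' (le_add_of_nonneg_left hs), add_sub_cancel_right]
    rw [e1, e2, e3] at hJ
    have hv := hP.v_le_J hrun
    rw [div_le_iff₀ hexp]
    linarith
  rw [div_le_iff₀ hexp] at key
  linarith

theorem Standing.v_eq_of_split (hP : P.Standing) {x : Plane} {q : P.states} {α : ℝ → A}
    {L₁ L₂ : List (ℝ × P.states)} {y : ℝ → Plane} {t : ℝ} (ht : 0 ≤ t)
    (h₁ : ∀ e ∈ L₁, e.1 ≤ t) (h₂ : ∀ e ∈ L₂, t ≤ e.1) (h : P.IsRun x q α (L₁ ++ L₂) y)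
    (hτ : (t : EReal) ≤ P.arrivalTime q (L₁ ++ L₂) y) (hopt : P.J q (L₁ ++ L₂) y = P.v x q) :
    P.v x q = P.runningCost y t + P.switchCost y q L₁ +
      Real.exp (-P.lam * t) * P.v (y t) (P.finalState q L₁) :=
  le_antisymm (hP.v_le_of_split ht h₁ h₂ h hτ) ((hP.le_J_of_split ht h₁ h₂ h hτ).trans_eq hopt)

theorem Standing.v_le_hybridCost (hP : P.Standing) {x : Plane} {q : P.states} {α : ℝ → A}
    {L : List (ℝ × P.states)} {y : ℝ → Plane} (h : P.IsRun x q α L y) {t : ℝ} (ht : 0 ≤ t)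
    (hτ : (t : EReal) ≤ P.arrivalTime q L y) : P.v x q ≤ P.hybridCost q L y t := by
  obtain ⟨L₂, h₂, hL⟩ := h.2.1.exists_split_lt t
  rw [hL] at h hτ
  exact hP.v_le_of_split ht fst_le_of_mem_before h₂ h hτ

/-- The hybrid cost at the stopped time lies between `v` and `J`, and the infimum of `J` is `v`. -/
theorem Standing.isGLB_hybridCost (hP : P.Standing) (x : Plane) (q : P.states) {t : ℝ}
    (ht : 0 ≤ t) :
    IsGLB {c | ∃ α L y, P.IsRun x q α L y ∧ c = P.hybridCost q L y (P.stopped q L y t)}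
      (P.v x q) := by
  constructor
  · rintro _ ⟨α, L, y, h, rfl⟩
    exact hP.v_le_hybridCost h (stopped_nonneg ht) (stopped_le_arrivalTime ht)
  · intro b hb
    exact hP.le_v fun α L y h => (hb ⟨α, L, y, h, rfl⟩).trans
      (hP.hybridCost_le_J h (stopped_nonneg ht) (stopped_le_arrivalTime ht))

/-! ### Optimal instantaneous switches -/

/-- If the strict inequality fails, some switch is free of loss by `v_le_add_switch`; performing it
decreases the number of unvisited checkpoints. -/
theorem Standing.exists_optimal_switches (hP : P.Standing) (x : Plane) (q : P.states) :
    ∃ L : List (ℝ × P.states), P.IsPlan q L ∧ (∀ e ∈ L, e.1 = 0) ∧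
      P.v x q = P.switchCost (fun _ => x) q L + P.v x (P.finalState q L) ∧
      P.StrictAt x (P.finalState q L) := by
  induction hn : m - visited q using Nat.strong_induction_on generalizing q with
  | _ n ih =>
    by_cases hs : P.StrictAt x q
    · exact ⟨[], hP.isPlan_nil q, by simp, by simp [switchCost, finalState], hs⟩
    simp only [StrictAt, not_forall, not_lt] at hs
    obtain ⟨w, hw, hne, hle⟩ := hs
    have hlt := hP.visited_lt hw hne
    have hwm := visited_le w
    obtain ⟨L, hL, h0, hv, hstrict⟩ := ih (m - visited w) (by omega) w rfl
    refine ⟨(0, w) :: L, hP.isPlan_cons_zero hw hne hL, by simpa using h0, ?_, hstrict⟩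
    have heq := le_antisymm (hP.v_le_add_switch x hw hne) hle
    rw [heq, hv]
    simp only [switchCost, finalState, mul_zero, Real.exp_zero, one_mul]
    ring

/-! ### The continuous-control principle -/

theorem Standing.continuousDPP_of_gap (hP : P.Standing) {x : Plane} {q : P.states} {t η : ℝ}
    (ht : 0 ≤ t) (hη : 0 < η)
    (hgap : ∀ α e L y, P.IsRun x q α (e :: L) y → e.1 < t →
      P.v x q + η ≤ P.J q (e :: L) y) : P.ContinuousDPP x q t := by
  constructor
  · rintro _ ⟨α, y, h, rfl⟩
    have := hP.v_le_of_split (L₁ := []) (L₂ := []) (stopped_nonneg ht) (by simp) (by simp) h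
      (stopped_le_arrivalTime (t := t) ht)
    simpa [switchCost, finalState] using this
  · intro b hb
    refine le_of_forall_pos_le_add fun ε hε => ?_
    -- Precision `η` rules out switches before `t`; precision `ε` gives the estimate.
    obtain ⟨α, L, y, h, hJ⟩ := hP.exists_J_lt x q (lt_min hε hη)
    have hL : ∀ e ∈ L, t ≤ e.1 := by
      cases L with
      | nil => simp
      | cons e L =>
        have het : t ≤ e.1 := by
          by_contra! hlt
          have := hgap α e L y h hlt
          linarith [min_le_right ε η]
        have hsorted := (List.pairwise_cons.1 (List.pairwise_map.1 h.2.1.sorted)).1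
        simpa [het] using fun a b hab => het.trans (hsorted (a, b) hab)
    -- The strategy may still switch from `t` on, so its future is replaced by a switch-free one;
    -- nothing up to the stopped time changes.
    obtain ⟨α', y', h'⟩ := hP.exists_isRun (y t) q
    obtain ⟨L', hL', rfl⟩ := exists_eq_delay hL
    have hrun : P.IsRun x q (glue t α α') [] (glue t y y') :=
      hP.isRun_glue (L₁ := []) ht (by simp) hL' h h'
    have hθ_eq : P.stopped q [] (glue t y y') t = P.stopped q (delay t L') y t := by
      rw [stopped, stopped, min_arrivalTime_congr (fun s _ hs => glue_of_lt y y' hs)]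
      intro s _ hs
      exact (stateAt_append_of_lt q [] hL hs).symm
    have hθ := stopped_le (P := P) (q := q) (L := delay t L') (y := y) ht
    have hbc := hb ⟨_, _, hrun, rfl⟩
    rw [hθ_eq, glue_of_le_of_eq h'.2.2.apply_zero hθ,
      runningCost_congr fun s _ hs => glue_of_lt y y' ((EReal.coe_lt_coe_iff.1 hs).trans_le hθ)]
      at hbc
    have hle := hP.le_J_of_split (L₁ := []) (stopped_nonneg ht) (by simp)
      (fun e he => hθ.trans (hL e he)) h (stopped_le_arrivalTime ht)
    simp only [switchCost, finalState, List.nil_append, add_zero] at hle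
    linarith [min_le_left ε η]

/-- A first switch at time `s < T` loses at least `exp (-λ s) * δ ≥ exp (-λ T) * δ`. -/
theorem Standing.continuousDPP_of_uniform_gap (hP : P.Standing) {x : Plane} {q : P.states}
    {T δ : ℝ} (hδ : 0 < δ)
    (hgap : ∀ α y, P.IsRun x q α [] y → ∀ s : ℝ, 0 ≤ s → s < T → ∀ q' ∈ P.permitted q, q' ≠ q →
      P.v (y s) q + δ ≤ P.v (y s) q' + P.C (y s) q q') {t : ℝ} (ht : 0 ≤ t) (htT : t ≤ T) :
    P.ContinuousDPP x q t := by
  refine hP.continuousDPP_of_gap ht (mul_pos (Real.exp_pos (-P.lam * T)) hδ) ?_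
  intro α e L y h het
  have he0 := h.2.1.nonneg e List.mem_cons_self
  have hperm := (P.permitted_cons.1 (hP.isPlan_iff.1 h.2.1).2.2).1
  obtain ⟨hτ, hJ⟩ := hP.first_switch_le_J h
  have hsorted : ∀ e' ∈ e :: L, e.1 ≤ e'.1 := by
    have := (List.pairwise_cons.1 (List.pairwise_map.1 h.2.1.sorted)).1
    simpa using fun a b hab => this (a, b) hab
  -- The margin is assumed only along switch-free trajectories, so `y` is continued past its first
  -- switch in the frozen state `q`.
  obtain ⟨α', y', h'⟩ := hP.exists_isRun (y e.1) q
  obtain ⟨L', hL', hL⟩ := exists_eq_delay hsorted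
  have hrun : P.IsRun x q (glue e.1 α α') [] (glue e.1 y y') :=
    hP.isRun_glue (L₁ := []) he0 (by simp) hL' (hL ▸ h) h'
  have hg := hgap _ _ hrun e.1 he0 (het.trans_le htT) e.2 hperm.1 hperm.2
  rw [glue_of_le_of_eq h'.2.2.apply_zero le_rfl] at hg
  have hv := hP.v_le_of_split (L₁ := []) he0 (by simp) hsorted h hτ
  simp only [switchCost, finalState, add_zero] at hv
  have hexp : Real.exp (-P.lam * T) ≤ Real.exp (-P.lam * e.1) := by
    refine Real.exp_le_exp.2 ?_
    nlinarith [hP.lam_pos]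
  have h1 := mul_le_mul_of_nonneg_left hg (Real.exp_pos (-P.lam * e.1)).le
  have h2 := mul_le_mul_of_nonneg_right hexp hδ.le
  linarith

theorem Standing.exists_continuousDPP_of_strictAt (hP : P.Standing) {x : Plane} {q : P.states}
    (hs : P.StrictAt x q)
    (hlsc : ∀ q' ∈ P.permitted q, q' ≠ q → LowerSemicontinuousAt (fun z => P.v z q') x) :
    ∃ t₀ : ℝ, 0 < t₀ ∧ ∀ t : ℝ, 0 ≤ t → t ≤ t₀ → P.ContinuousDPP x q t := by
  -- A level `c` strictly between `v x q` and all the switching values exists because there are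
  -- finitely many states; lower semicontinuity keeps those values above `c` near `x`.
  obtain ⟨c, hc, hvc⟩ : ∃ c : ℝ, (∀ q', q' ∈ P.permitted q → q' ≠ q →
      c < P.v x q' + P.C x q q') ∧ P.v x q < c := by
    have h1 : ∀ᶠ c in nhdsWithin (P.v x q) (Set.Ioi (P.v x q)), ∀ q', q' ∈ P.permitted q →
        q' ≠ q → c < P.v x q' + P.C x q q' := by
      refine Filter.eventually_all.2 fun q' => ?_
      by_cases hq' : q' ∈ P.permitted q ∧ q' ≠ q
      · filter_upwards [Ioo_mem_nhdsGT (hs q' hq'.1 hq'.2)] with c hc _ _ using hc.2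
      · exact Filter.Eventually.of_forall fun c h h' => absurd ⟨h, h'⟩ hq'
    exact (h1.and self_mem_nhdsWithin).exists
  have hnear : ∀ᶠ z in nhds x, ∀ q', q' ∈ P.permitted q → q' ≠ q →
      c < P.v z q' + P.C z q q' := by
    refine Filter.eventually_all.2 fun q' => ?_
    by_cases hq' : q' ∈ P.permitted q ∧ q' ≠ q
    · have hl := (hlsc q' hq'.1 hq'.2).add
        (hP.C_continuous q q' hq'.1 hq'.2).continuousAt.lowerSemicontinuousAt
      filter_upwards [hl c (hc q' hq'.1 hq'.2)] with z hz _ _ using hz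
    · exact Filter.Eventually.of_forall fun z h h' => absurd ⟨h, h'⟩ hq'
  obtain ⟨r, hr, hball⟩ := Metric.eventually_nhds_iff.1 hnear
  obtain ⟨M, hM⟩ := hP.ell_bounded
  obtain ⟨M', hM'⟩ := hP.f_bounded
  -- At `s = 0` the right side is `c`, above the midpoint, so an early switch costs at least `v x q
  -- + (c - v x q) / 2`. The second condition keeps the trajectory in the ball of radius `r`.
  have hsmall : ∀ᶠ s : ℝ in nhds 0,
      (P.v x q + c) / 2 < -(M * s) + Real.exp (-P.lam * s) * c ∧ M' * s < r := by
    have h1 : Continuous fun s : ℝ => -(M * s) + Real.exp (-P.lam * s) * c := by fun_prop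
    have h2 : Continuous fun s : ℝ => M' * s := by fun_prop
    refine (h1.continuousAt.eventually_const_lt ?_).and (h2.continuousAt.eventually_lt_const ?_)
    · simp only [mul_zero, neg_zero, Real.exp_zero, one_mul, zero_add]
      linarith
    · simpa using hr
  obtain ⟨t₀, ht₀, hsm⟩ := Metric.eventually_nhds_iff.1 hsmall
  refine ⟨t₀, ht₀, fun t ht htt => hP.continuousDPP_of_gap ht
    (by linarith : 0 < (c - P.v x q) / 2) fun α e L y h het => ?_⟩
  have he0 := h.2.1.nonneg e List.mem_cons_self
  have hperm := (P.permitted_cons.1 (hP.isPlan_iff.1 h.2.1).2.2).1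
  have hJ := (hP.first_switch_le_J h).2
  obtain ⟨hs1, hs2⟩ := hsm (y := e.1) (by
    rw [Real.dist_eq, sub_zero, abs_of_nonneg he0]
    exact het.trans_le htt)
  have hz := hball ((h.dist_le hM' he0).trans_lt hs2) e.2 hperm.1 hperm.2
  have hrc := (abs_le.1 (hP.abs_runningCost_le hM y he0)).1
  have hmul := mul_le_mul_of_nonneg_left hz.le (Real.exp_pos (-P.lam * e.1)).le
  linarith

/-- Cutting the optimal strategy at `t'` and at `t` gives two expressions for `v x q` with the same
preceding switches, so the switching costs cancel. -/
theorem Standing.v_eq_along_optimal (hP : P.Standing) {x : Plane} {q w : P.states} {α : ℝ → A}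
    {L : List (ℝ × P.states)} {y : ℝ → Plane} (h : P.IsRun x q α L y)
    (hopt : P.J q L y = P.v x q) {t' t : ℝ} (ht' : 0 ≤ t') (htt : t' < t)
    (hτ : (t : EReal) ≤ P.arrivalTime q L y)
    (hw : ∀ s : ℝ, t' ≤ s → s < t → P.stateAt q L s = w) :
    P.v (y t') w = (∫ s in t'..t, P.ell (y s) * Real.exp (-P.lam * (s - t'))) +
      Real.exp (-P.lam * (t - t')) * P.v (y t) w := by
  have ht : 0 ≤ t := ht'.trans htt.le
  have hbefore := hP.before_eq_of_stateAt_eq h.2.1 htt hw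
  have hfs : P.finalState q (P.before t L) = w := by
    rw [hbefore]
    exact hw t' le_rfl htt
  have hτ' : (t' : EReal) ≤ P.arrivalTime q L y := (EReal.coe_le_coe_iff.2 htt.le).trans hτ
  obtain ⟨L₂, h₂, hL⟩ := h.2.1.exists_split_lt t
  have e1 : P.v x q = P.runningCost y t + P.switchCost y q (P.before t L) +
      Real.exp (-P.lam * t) * P.v (y t) (P.finalState q (P.before t L)) :=
    hP.v_eq_of_split ht fst_le_of_mem_before h₂ (hL ▸ h) (hL ▸ hτ) (hL ▸ hopt)
  -- Switches at time exactly `t'` are put before the cut, so that the state there is `Q(t') = w`.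
  have e2 : P.v x q = P.runningCost y t' + P.switchCost y q (P.before t L) +
      Real.exp (-P.lam * t') * P.v (y t') (P.finalState q (P.before t L)) := by
    refine hP.v_eq_of_split ht' (fun e he => ?_) (fun e he => htt.le.trans (h₂ e he)) (hL ▸ h)
      (hL ▸ hτ') (hL ▸ hopt)
    rw [hbefore] at he
    simpa using (List.mem_filter.1 he).2
  rw [hfs, runningCost_eq_intervalIntegral y ht] at e1
  rw [hfs, runningCost_eq_intervalIntegral y ht'] at e2
  have hint : ∀ {a b : ℝ}, 0 ≤ a → 0 ≤ b → IntervalIntegrable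
      (fun s => P.ell (y s) * Real.exp (-P.lam * s)) volume a b := fun ha hb =>
    intervalIntegrable_iff.2 ((hP.integrableOn_running h.2.2.1).mono_set fun s hs =>
      (le_min ha hb).trans hs.1.le)
  have hsplit := intervalIntegral.integral_add_adjacent_intervals (hint le_rfl ht') (hint ht' ht)
  have hscale : ∫ s in t'..t, P.ell (y s) * Real.exp (-P.lam * (s - t')) =
      Real.exp (P.lam * t') * ∫ s in t'..t, P.ell (y s) * Real.exp (-P.lam * s) := by
    rw [← intervalIntegral.integral_const_mul]
    congr 1
    funext s
    rw [mul_left_comm, ← Real.exp_add]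
    ring_nf
  have hexp : Real.exp (-P.lam * (t - t')) = Real.exp (P.lam * t') * Real.exp (-P.lam * t) := by
    rw [← Real.exp_add]
    ring_nf
  have hone : Real.exp (P.lam * t') * Real.exp (-P.lam * t') = 1 := by
    rw [← Real.exp_add]
    simp
  rw [hscale, hexp]
  linear_combination Real.exp (P.lam * t') * (e1 - e2) - Real.exp (P.lam * t') * hsplit -
    P.v (y t') w * hone

end Orienteering

theorem mainTheorem2 {m : ℕ} {A : Type*} [MeasurableSpace A] [Nonempty A]
    (P : Orienteering m A) (hP : P.Standing) :
    -- the value function is a genuine (finite) infimum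
    (∀ x q, IsGLB {c | ∃ α L y, P.IsRun x q α L y ∧ c = P.J q L y} (P.v x q)) ∧
    -- by optimal instantaneous switches a state with the strict inequality is reached
    (∀ x q, ∃ L : List (ℝ × P.states), P.IsPlan q L ∧ (∀ e ∈ L, e.1 = 0) ∧
      P.v x q = P.switchCost (fun _ => x) q L + P.v x (P.finalState q L) ∧
      P.StrictAt x (P.finalState q L)) ∧
    -- strict inequality at a point of lower semicontinuity: continuous DPP for small times
    (∀ x q, P.StrictAt x q →
      (∀ q' ∈ P.permitted q, q' ≠ q → LowerSemicontinuousAt (fun z => P.v z q') x) →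
      ∃ t₀ : ℝ, 0 < t₀ ∧ ∀ t : ℝ, 0 ≤ t → t ≤ t₀ → P.ContinuousDPP x q t) ∧
    -- strict inequality, uniformly on a whole time interval: continuous DPP on that interval
    (∀ x q (T δ : ℝ), 0 < δ →
      (∀ α y, P.IsRun x q α [] y → ∀ s : ℝ, 0 ≤ s → s < T → ∀ q' ∈ P.permitted q, q' ≠ q →
        P.v (y s) q + δ ≤ P.v (y s) q' + P.C (y s) q q') →
      ∀ t : ℝ, 0 ≤ t → t ≤ T → P.ContinuousDPP x q t) ∧
    -- continuous DPP along an optimal strategy, between two switching times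
    (∀ x q α L y, P.IsRun x q α L y → P.J q L y = P.v x q →
      ∀ t' t : ℝ, 0 ≤ t' → t' ≤ t → (t : EReal) ≤ P.arrivalTime q L y →
        ∀ w, P.stateAt q L t' = w → (∀ s : ℝ, t' ≤ s → s < t → P.stateAt q L s = w) →
        P.v (y t') w = (∫ s in t'..t, P.ell (y s) * Real.exp (-P.lam * (s - t'))) +
          Real.exp (-P.lam * (t - t')) * P.v (y t) w) ∧
    -- the hybrid DPP
    (∀ x q (t : ℝ), 0 ≤ t →
      IsGLB {c | ∃ α L y, P.IsRun x q α L y ∧ c = P.hybridCost q L y (P.stopped q L y t)}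
        (P.v x q)) ∧
    -- no strategy does better at any time up to its arrival time ...
    (∀ x q α L y, P.IsRun x q α L y → ∀ t : ℝ, 0 ≤ t → (t : EReal) ≤ P.arrivalTime q L y →
      P.v x q ≤ P.hybridCost q L y t) ∧
    -- ... and there is equality along optimal strategies
    (∀ x q α L y, P.IsRun x q α L y → P.J q L y = P.v x q →
      ∀ t : ℝ, 0 ≤ t → (t : EReal) ≤ P.arrivalTime q L y →
        P.v x q = P.hybridCost q L y t) := by
  refine ⟨hP.isGLB_v, hP.exists_optimal_switches,
    fun x q hs hlsc => hP.exists_continuousDPP_of_strictAt hs hlsc,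
    fun x q T δ hδ hgap t ht htT => hP.continuousDPP_of_uniform_gap hδ hgap ht htT, ?_,
    fun x q t ht => hP.isGLB_hybridCost x q ht,
    fun x q α L y h t ht hτ => hP.v_le_hybridCost h ht hτ,
    fun x q α L y h hopt t ht hτ => le_antisymm (hP.v_le_hybridCost h ht hτ)
      ((hP.hybridCost_le_J h ht hτ).trans_eq hopt)⟩
  intro x q α L y h hopt t' t ht' htt hτ w _ hw
  -- For `t' = t` the integral vanishes and the factor is `1`; only `t' < t` involves the strategy.
  rcases htt.eq_or_lt with rfl | htt
  · simp
  · exact hP.v_eq_along_optimal h hopt ht' htt hτ hw
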